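/- A hypergraph is a finite vertex set together with a finite family of nonempty vertex subsets (hyperedges; repetitions allowed, repeated hyperedges being distinct). For real $\kappa$, a hypergraph $H$ is $\kappa$-weakly-partition-connected if every partition $\mathcal P$ of its vertex set satisfies $\sum_{e\in E(H)}(\mathcal P(e)-1)\ge \kappa(|\mathcal P|-1)$, where $\mathcal P(e)$ is the number of parts of $\mathcal P$ that $e$ meets. A tree-assignment of $H$ is an edge-labeled multigraph on the vertices of $H$ obtained by replacing each hyperedge $e$ with a simple graph with $|e|-1$ edges on the vertices of $e$, each of these edges being labeled by $e$. A $k$-tree-decomposition of an edge-labeled graph $G$ on $t$ vertices is an ordered partition $(T_0,\dots,T_{k-1})$ of its edges into $k$ spanning trees; its signature is the vector $\sum_{i=0}^{k-1} i\cdot v^{T_i}$, where $v^{T}_e$ is the number of edges of $T$ with label $e$. The graph $G$ is $k$-distinguishable if it has exactly $k(t-1)$ edges and has a $k$-tree-decomposition whose signature differs from that of every other $k$-tree-decomposition of $G$. For real $C\ge 1$ and a positive integer $t$, the hypergraph conjecture with parameters $(C,t)$ is the assertion: for every positive integer $k$, every $Ck$-weakly-partition-connected hypergraph on $t$ vertices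 has a tree-assignment with a $k$-distinguishable subgraph on the same $t$ vertices. For $1\le k<n$ and distinct $\alpha_1,\dots,\alpha_n\in\mathbb F_q$, the $[n,k]$-Reed–Solomon (RS) code with evaluation points $\alpha_1,\dots,\alpha_n$ is $\{(f(\alpha_1),\dots,f(\alpha_n)) : f\in\mathbb F_q[x],\ \deg f<k\}$. The rate of a code $\mathcal C\subseteq\mathbb F_q^n$ is $\log_q|\mathcal C|/n$. For real $\rho$, the code is $(\rho,L)$-list-decodable if for every $y\in\mathbb F_q^n$ at most $L$ codewords $c\in\mathcal C$ differ from $y$ in at most $\rho n$ coordinates. **Theorem.** There is a function $q_0:\mathbb N^2\to\mathbb N$ such that the following holds. Let $L\ge 1$ be an integer and $C\ge 1$ a real number such that the hypergraph conjecture holds with parameters $(C,t)$ for every positive integer $t\le L+1$. Then for all integers $1\le k<n$ and every finite field $\mathbb F_q$ with $q\ge q_0(n,L)$, there are distinct $\alpha_1,\dots,\alpha_n\in\mathbb F_q$ such that the $[n,k]$-RS code with evaluation points $\alpha_1,\dots,\alpha_n$ has rate $R=k/n$ and is $\left(\frac{L}{L+1}(1-CR),\,L\right)$-list-decodable. -/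

import Mathlib

open Finset
open scoped Polynomial

/-- A (multi)hypergraph on the vertex set `V`: a family of nonempty subsets of `V`, indexed by `E`.
Different indices may carry the same vertex set. -/
structure MultiHypergraph (V E : Type*) where
  edge : E → Finset V
  edge_nonempty : ∀ e, (edge e).Nonempty

/-- `partsMet P S` is the number of parts of the partition `P` that the vertex set `S` intersects. -/
def partsMet {V : Type*} [Fintype V] [DecidableEq V]
    (P : Finpartition (univ : Finset V)) (S : Finset V) : ℕ :=
  #{A ∈ P.parts | (S ∩ A).Nonempty}

/-- `H` is `κ`-weakly-partition-connected (`κ` real): for every partition `P` of the vertices,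
`∑ e, (P(e) - 1) ≥ κ (|P| - 1)`. -/
def WeaklyPartitionConnected {V E : Type*} [Fintype V] [DecidableEq V] [Fintype E]
    (κ : ℝ) (H : MultiHypergraph V E) : Prop :=
  ∀ P : Finpartition (univ : Finset V),
    κ * ((#P.parts : ℝ) - 1) ≤ ∑ e, ((partsMet P (H.edge e) : ℝ) - 1)

/-- A graph on `V` with edges labeled by `E`, given by its finite set of pairs
(label, unordered pair of endpoints). Edges with different labels may be parallel. -/
abbrev LabeledGraph (V E : Type*) := Finset (E × Sym2 V)

/-- `G` is a tree-assignment of `H`: every hyperedge `e` is replaced by a loopless simple graph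
with `|e| - 1` edges on the vertices of `e`, all of whose edges are labeled `e`. -/
def IsTreeAssignment {V E : Type*} [DecidableEq E]
    (H : MultiHypergraph V E) (G : LabeledGraph V E) : Prop :=
  (∀ p ∈ G, ¬ p.2.IsDiag ∧ ∀ v ∈ p.2, v ∈ H.edge p.1) ∧
    ∀ e, #{p ∈ G | p.1 = e} + 1 = #(H.edge e)

/-- The edges of `T` form a spanning tree of the vertex set `V`: there are no loops and no parallel
edges, and the underlying simple graph on all of `V` is a tree. -/
def IsSpanningTree {V E : Type*} (T : LabeledGraph V E) : Prop :=
  (∀ p ∈ T, ¬ p.2.IsDiag) ∧ Set.InjOn Prod.snd (T : Set (E × Sym2 V)) ∧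
    (SimpleGraph.fromEdgeSet (Prod.snd '' (T : Set (E × Sym2 V)))).IsTree

/-- `T 0, …, T (k-1)` is a `k`-tree-decomposition of `G`: a partition of the edges of `G` into `k`
spanning trees. -/
def IsTreeDecomposition {V E : Type*} {k : ℕ}
    (G : LabeledGraph V E) (T : Fin k → LabeledGraph V E) : Prop :=
  (∀ i, IsSpanningTree (T i)) ∧ (∀ i j, i ≠ j → Disjoint (T i) (T j)) ∧
    ∀ p, p ∈ G ↔ ∃ i, p ∈ T i

/-- The signature `∑ i, i • v^{T i}`, where `v^{T i}` counts the edges of each label in `T i`. -/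
def signature {V E : Type*} [DecidableEq E] {k : ℕ} (T : Fin k → LabeledGraph V E) : E → ℕ :=
  fun e => ∑ i : Fin k, (i : ℕ) * #{p ∈ T i | p.1 = e}

/-- `G` is `k`-distinguishable: it has `k (|V| - 1)` edges and a `k`-tree-decomposition that is
determined by its signature. -/
def IsDistinguishable {V E : Type*} [Fintype V] [DecidableEq E]
    (k : ℕ) (G : LabeledGraph V E) : Prop :=
  #G = k * (Fintype.card V - 1) ∧
    ∃ T : Fin k → LabeledGraph V E, IsTreeDecomposition G T ∧
      ∀ T' : Fin k → LabeledGraph V E,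
        IsTreeDecomposition G T' → signature T' = signature T → T' = T

/-- The hypergraph conjecture with parameters `C` and `t`: for every positive `k`, every
`C k`-weakly-partition-connected hypergraph on `t` vertices has a tree-assignment with a
`k`-distinguishable subgraph (on the same `t` vertices). -/
def HypergraphConjecture (C : ℝ) (t : ℕ) : Prop :=
  ∀ k : ℕ, 1 ≤ k → ∀ (m : ℕ) (H : MultiHypergraph (Fin t) (Fin m)),
    WeaklyPartitionConnected (C * k) H →
      ∃ G : LabeledGraph (Fin t) (Fin m), IsTreeAssignment H G ∧ ∃ G' ⊆ G, IsDistinguishable k G'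

/-- The Reed–Solomon code of dimension parameter `k` with evaluation points `α`. -/
def rsCode {F : Type*} [Field F] {n : ℕ} (k : ℕ) (α : Fin n → F) : Set (Fin n → F) :=
  {c | ∃ f : F[X], f.degree < (k : WithBot ℕ) ∧ c = fun i => f.eval (α i)}

/-- The rate `log_q |𝒞| / n` of a code `𝒞 ⊆ F ^ n`, where `q = |F|`. -/
noncomputable def codeRate {F : Type*} [Fintype F] {n : ℕ} (𝒞 : Set (Fin n → F)) : ℝ :=
  Real.logb (Fintype.card F) (Nat.card 𝒞) / n

/-- `(ρ, L)`-list-decodability with respect to the relative Hamming distance. -/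
def IsListDecodable {F : Type*} [DecidableEq F] {n : ℕ}
    (𝒞 : Set (Fin n → F)) (ρ : ℝ) (L : ℕ) : Prop :=
  ∀ y : Fin n → F, {c ∈ 𝒞 | (hammingDist c y : ℝ) / n ≤ ρ}.encard ≤ L

/-!
A word with more than `L` codewords nearby gives a hypergraph: its vertices are `L + 1` of these
codewords, given by polynomials `f v` of degree `< k`, and the edge of coordinate `i` consists of
those that agree with the word there. Counting agreements makes its edges large on average, namely
`∑ (|e| - 1) ≥ L C k`, and on a smallest vertex set of at least two vertices that is this dense the
hypergraph is `C k`-weakly-partition-connected (`exists_weaklyPartitionConnected`). The hypergraph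
conjecture then supplies a `k`-distinguishable graph each of whose edges, with label `i` and ends
`u, v`, stands for an equation `f u (α i) = f v (α i)`.

After fixing a root `r`, these equations are a square linear system in the coefficients of the
differences `f v - f r`. By multilinearity in the rows its determinant, a polynomial in `α`, is a sum
over the ways of distributing the graph's edges over the `k` coefficient blocks
(`det_evaluationMatrix`); a distribution contributes the monomial given by its signature, with a
coefficient that is nonzero in the field exactly when it is a decomposition into spanning trees. The
distinguished signature occurs once, so the determinant is not the zero polynomial, whatever the
characteristic (`evaluationDet_ne_zero`). The degrees and the number of the graphs are bounded in
terms of `n` and `L` alone, so over a large field there are distinct evaluation points at which none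
of these determinants vanishes (`exists_injective_isGenericForGraphs`). There the system forces the
polynomials to coincide, although they belong to different codewords.
-/

/-! ### A weakly partition-connected subhypergraph -/

section SubHypergraph

lemma card_le_partsMet_add_sum {V : Type*} [Fintype V] [DecidableEq V]
    (P : Finpartition (univ : Finset V)) (S : Finset V) :
    #S ≤ partsMet P S + ∑ A ∈ P.parts, (#(S ∩ A) - 1) := by
  have h1 : #S = ∑ A ∈ P.parts, #(S ∩ A) := by
    have hS : P.parts.biUnion (fun A => S ∩ A) = S := by
      ext v
      simp only [mem_biUnion, mem_inter]
      constructor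
      · rintro ⟨_, _, hv, _⟩
        exact hv
      · intro hv
        obtain ⟨A, hA, hvA⟩ := P.exists_mem (mem_univ v)
        exact ⟨A, hA, hv, hvA⟩
    have hdisj : (P.parts : Set (Finset V)).PairwiseDisjoint (fun A => S ∩ A) :=
      fun A hA B hB hAB => (P.disjoint hA hB hAB).mono inter_subset_right inter_subset_right
    rw [← card_biUnion hdisj, hS]
  rw [h1, partsMet, Finset.card_filter, ← Finset.sum_add_distrib]
  refine Finset.sum_le_sum fun A _ => ?_
  split_ifs with h
  · omega
  · rw [Finset.not_nonempty_iff_eq_empty] at h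
    simp [h]

lemma one_le_partsMet {V : Type*} [Fintype V] [DecidableEq V]
    (P : Finpartition (univ : Finset V)) {S : Finset V} (hS : S.Nonempty) :
    1 ≤ partsMet P S := by
  obtain ⟨v, hv⟩ := hS
  obtain ⟨A, hA, hvA⟩ := P.exists_mem (mem_univ v)
  exact Finset.card_pos.2 ⟨A, mem_filter.2 ⟨hA, v, mem_inter.2 ⟨hv, hvA⟩⟩⟩

/-- A hypergraph that is dense as a whole and sparse on each proper vertex subset is weakly
partition-connected: what the edges have beyond their traces inside the parts must cross between
parts. -/
lemma weaklyPartitionConnected_of_dense {V E : Type*} [Fintype V] [DecidableEq V] [Fintype E]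
    (κ : ℝ) (H : MultiHypergraph V E)
    (hdense : κ * ((Fintype.card V : ℝ) - 1) ≤ ∑ e, ((#(H.edge e) - 1 : ℕ) : ℝ))
    (hsparse : ∀ A : Finset V, A.Nonempty → A ≠ univ →
      ∑ e, ((#(H.edge e ∩ A) - 1 : ℕ) : ℝ) ≤ κ * ((#A : ℝ) - 1)) :
    WeaklyPartitionConnected κ H := by
  intro P
  by_cases htriv : univ ∈ P.parts
  · have hparts : P.parts = {univ} := by
      refine Finset.eq_singleton_iff_unique_mem.2 ⟨htriv, fun A hA => ?_⟩
      by_contra hne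
      have := P.disjoint hA htriv hne
      exact P.ne_bot hA (by simpa [disjoint_iff] using this)
    rw [hparts]
    simp only [card_singleton, Nat.cast_one, sub_self, mul_zero]
    refine Finset.sum_nonneg fun e _ => ?_
    have := one_le_partsMet P (H.edge_nonempty e)
    rw [sub_nonneg]
    exact_mod_cast this
  · have h1 : ∀ e, ((#(H.edge e) - 1 : ℕ) : ℝ) - ∑ A ∈ P.parts, ((#(H.edge e ∩ A) - 1 : ℕ) : ℝ) ≤
        (partsMet P (H.edge e) : ℝ) - 1 := by
      intro e
      have h2 : (#(H.edge e) : ℝ) ≤ partsMet P (H.edge e) +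
          ∑ A ∈ P.parts, ((#(H.edge e ∩ A) - 1 : ℕ) : ℝ) := by
        exact_mod_cast card_le_partsMet_add_sum P (H.edge e)
      have h3 : ((#(H.edge e) - 1 : ℕ) : ℝ) = (#(H.edge e) : ℝ) - 1 := by
        rw [Nat.cast_sub (Finset.card_pos.2 (H.edge_nonempty e)), Nat.cast_one]
      linarith
    have h4 : ∑ A ∈ P.parts, ∑ e, ((#(H.edge e ∩ A) - 1 : ℕ) : ℝ) ≤
        ∑ A ∈ P.parts, κ * ((#A : ℝ) - 1) :=
      Finset.sum_le_sum fun A hA => hsparse A (P.nonempty_of_mem_parts hA)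
        (fun h => htriv (h ▸ hA))
    have h5 : ∑ A ∈ P.parts, κ * ((#A : ℝ) - 1) = κ * ((Fintype.card V : ℝ) - #P.parts) := by
      rw [← Finset.mul_sum, Finset.sum_sub_distrib, ← Nat.cast_sum, P.sum_card_parts]
      simp
    have h6 := Finset.sum_le_sum fun e (_ : e ∈ univ) => h1 e
    rw [Finset.sum_sub_distrib, Finset.sum_comm] at h6
    linarith

/-- Restricting to a smallest dense set of at least two vertices. Edges disjoint from that set are
replaced by singletons, which play no role. -/
lemma exists_weaklyPartitionConnected {W E : Type*} [Fintype W] [DecidableEq W] [Fintype E]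
    (κ : ℝ) (S : E → Finset W) (hW : 2 ≤ Fintype.card W)
    (hdense : κ * ((Fintype.card W : ℝ) - 1) ≤ ∑ e, ((#(S e) - 1 : ℕ) : ℝ)) :
    ∃ t, 2 ≤ t ∧ t ≤ Fintype.card W ∧ ∃ (ψ : Fin t ↪ W) (H : MultiHypergraph (Fin t) E),
      WeaklyPartitionConnected κ H ∧
        ∀ e, 2 ≤ #(H.edge e) → ∀ v ∈ H.edge e, ψ v ∈ S e := by
  classical
  let good : Finset (Finset W) := univ.filter fun J => 2 ≤ #J ∧
    κ * ((#J : ℝ) - 1) ≤ ∑ e, ((#(S e ∩ J) - 1 : ℕ) : ℝ)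
  have hgood : good.Nonempty := ⟨univ, by simpa [good] using ⟨hW, hdense⟩⟩
  obtain ⟨J, hJ, hmin⟩ := Finset.exists_min_image good (fun J => #J) hgood
  obtain ⟨-, hJ2, hJd⟩ := Finset.mem_filter.1 hJ
  let ψ : Fin #J ↪ W := J.equivFin.symm.toEmbedding.trans (Function.Embedding.subtype _)
  have hψ : ∀ A : Finset (Fin #J), A.map ψ ⊆ J := by
    intro A w hw
    obtain ⟨v, -, rfl⟩ := Finset.mem_map.1 hw
    exact (J.equivFin.symm v).2
  have huniv : (univ : Finset (Fin #J)).map ψ = J :=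
    Finset.eq_of_subset_of_card_le (hψ _) (by simp)
  let Q : E → Finset (Fin #J) := fun e => univ.filter fun v => ψ v ∈ S e
  have hQ : ∀ e A, #(Q e ∩ A) = #(S e ∩ A.map ψ) := by
    intro e A
    rw [← Finset.card_map ψ]
    congr 1
    ext w
    simp only [mem_map, mem_inter, Q, mem_filter, mem_univ, true_and]
    constructor
    · rintro ⟨v, ⟨h1, h2⟩, rfl⟩
      exact ⟨h1, v, h2, rfl⟩
    · rintro ⟨h1, v, h2, rfl⟩
      exact ⟨v, ⟨h1, h2⟩, rfl⟩
  let v₀ : Fin #J := ⟨0, by omega⟩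
  let H : MultiHypergraph (Fin #J) E :=
    { edge := fun e => if (Q e).Nonempty then Q e else {v₀}
      edge_nonempty := by
        intro e
        split_ifs with h
        · exact h
        · exact singleton_nonempty _ }
  have hH : ∀ e A, #(H.edge e ∩ A) - 1 = #(S e ∩ A.map ψ) - 1 := by
    intro e A
    rw [← hQ]
    by_cases h : (Q e).Nonempty
    · simp [H, h]
    · have h1 : #({v₀} ∩ A) ≤ 1 := (card_le_card inter_subset_left).trans (by simp)
      rw [Finset.not_nonempty_iff_eq_empty] at h
      simp only [H, h, Finset.not_nonempty_empty, if_false, empty_inter, card_empty]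
      omega
  refine ⟨#J, hJ2, card_le_univ J, ψ, H, weaklyPartitionConnected_of_dense κ H ?_ ?_, ?_⟩
  · have : ∀ e, #(H.edge e) - 1 = #(S e ∩ J) - 1 := by
      intro e
      have := hH e univ
      rwa [inter_univ, huniv] at this
    simpa [this] using hJd
  · intro A hA hAne
    simp only [hH]
    rcases Nat.lt_or_ge #A 2 with hlt | hge
    -- A single vertex is sparse because both sides vanish; minimality covers only larger sets.
    · have hA1 : #A = 1 := by
        have := Finset.card_pos.2 hA
        omega
      have h0 : ∀ e, #(S e ∩ A.map ψ) - 1 = 0 := by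
        intro e
        have := card_le_card (inter_subset_right : S e ∩ A.map ψ ⊆ A.map ψ)
        rw [card_map] at this
        omega
      simp [h0, hA1]
    · by_contra! hlt
      have hmem : A.map ψ ∈ good := by
        simp only [good, mem_filter, mem_univ, true_and, card_map]
        exact ⟨hge, hlt.le⟩
      have h1 := hmin _ hmem
      rw [card_map] at h1
      refine hAne (Finset.eq_univ_of_card _ ?_)
      have := card_le_univ A
      simp only [Fintype.card_fin] at this ⊢
      omega
  · intro e he v hv
    by_cases h : (Q e).Nonempty
    · simp only [H, h, if_true] at hv
      exact (mem_filter.1 hv).2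
    · simp [H, h] at he

end SubHypergraph

/-! ### The evaluation matrix of a labelled graph -/

lemma mk_out_eq {V : Type*} (p : Sym2 V) : s((Quot.out p).1, (Quot.out p).2) = p :=
  Quot.out_eq p

section Determinant

variable {V E F : Type*} [Fintype V] [DecidableEq V] [Field F]

/-- The row of the (oriented) incidence matrix belonging to the edge `p`. The orientation is the
arbitrary one given by `Quot.out`; loops give the zero row. -/
noncomputable def incidenceRow (F : Type*) [Field F] (p : Sym2 V) (v : V) : F :=
  (if v = (Quot.out p).1 then 1 else 0) - (if v = (Quot.out p).2 then 1 else 0)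

/-- Extension of a function on the non-root vertices by zero at the root `r`. -/
def extendByZero (r : V) (x : {v : V // v ≠ r} → F) (v : V) : F :=
  if h : v ≠ r then x ⟨v, h⟩ else 0

lemma sum_incidenceRow_mul (r : V) (p : Sym2 V) (x : {v : V // v ≠ r} → F) :
    ∑ v : {v : V // v ≠ r}, incidenceRow F p v * x v =
      extendByZero r x (Quot.out p).1 - extendByZero r x (Quot.out p).2 := by
  have h1 : ∀ w : V, ∑ v : {v : V // v ≠ r}, (if (v : V) = w then (1 : F) else 0) * x v =
      extendByZero r x w := by
    intro w
    unfold extendByZero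
    split_ifs with h
    · rw [Finset.sum_eq_single ⟨w, h⟩]
      · simp
      · intro b _ hb
        rw [if_neg (fun hh => hb (Subtype.ext hh)), zero_mul]
      · simp
    · refine Finset.sum_eq_zero fun v _ => ?_
      have : (v : V) ≠ w := fun hh => h (hh ▸ v.2)
      simp [this]
  simp only [incidenceRow, sub_mul, Finset.sum_sub_distrib, h1]

variable {k : ℕ} {r : V}

/-- The coefficient matrix of the system `f u (α e) = f v (α e)`, one equation for each labelled
edge `φ c = (e, s(u, v))`, in the unknown coefficients of `f v - f r` (`v ≠ r`). -/
noncomputable def evaluationMatrix (φ : Fin k × {v : V // v ≠ r} → E × Sym2 V) (α : E → F) :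
    Matrix (Fin k × {v : V // v ≠ r}) (Fin k × {v : V // v ≠ r}) F :=
  fun c d => α (φ c).1 ^ (d.1 : ℕ) * incidenceRow F (φ c).2 d.2

/-- The matrix obtained by keeping, in the row of each edge `φ c`, only the block of columns
indexed by `τ c`. -/
noncomputable def blockMatrix (F : Type*) [Field F] (φ : Fin k × {v : V // v ≠ r} → E × Sym2 V)
    (τ : Fin k × {v : V // v ≠ r} → Fin k) :
    Matrix (Fin k × {v : V // v ≠ r}) (Fin k × {v : V // v ≠ r}) F :=
  fun c d => if d.1 = τ c then incidenceRow F (φ c).2 d.2 else 0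

/-- Expansion by multilinearity in the rows. -/
lemma det_evaluationMatrix (φ : Fin k × {v : V // v ≠ r} → E × Sym2 V) (α : E → F) :
    (evaluationMatrix φ α).det =
      ∑ τ : Fin k × {v : V // v ≠ r} → Fin k,
        (∏ c, α (φ c).1 ^ (τ c : ℕ)) * (blockMatrix F φ τ).det := by
  have h : evaluationMatrix φ α = fun c => ∑ i : Fin k, α (φ c).1 ^ (i : ℕ) •
      (fun d : Fin k × {v : V // v ≠ r} => if d.1 = i then incidenceRow F (φ c).2 d.2 else 0) := by
    funext c d
    simp [evaluationMatrix, Finset.sum_apply]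
  rw [h]
  refine ((Matrix.detRowAlternating (n := Fin k × {v : V // v ≠ r})
    (R := F)).toMultilinearMap.map_sum (fun c (i : Fin k) => α (φ c).1 ^ (i : ℕ) •
      (fun d : Fin k × {v : V // v ≠ r} =>
        if d.1 = i then incidenceRow F (φ c).2 d.2 else 0))).trans ?_
  refine Finset.sum_congr rfl fun τ _ => ?_
  exact (Matrix.detRowAlternating (n := Fin k × {v : V // v ≠ r})
    (R := F)).toMultilinearMap.map_smul_univ (fun c => α (φ c).1 ^ (τ c : ℕ)) (fun c (d : Fin k × {v : V // v ≠ r}) =>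
        if d.1 = τ c then incidenceRow F (φ c).2 d.2 else 0)

lemma blockMatrix_mulVec (φ : Fin k × {v : V // v ≠ r} → E × Sym2 V)
    (τ : Fin k × {v : V // v ≠ r} → Fin k) (x : Fin k × {v : V // v ≠ r} → F)
    (c : Fin k × {v : V // v ≠ r}) :
    (blockMatrix F φ τ).mulVec x c =
      extendByZero r (fun v => x (τ c, v)) (Quot.out (φ c).2).1 -
        extendByZero r (fun v => x (τ c, v)) (Quot.out (φ c).2).2 := by
  rw [← sum_incidenceRow_mul]
  simp only [Matrix.mulVec, dotProduct, blockMatrix, Fintype.sum_prod_type]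
  rw [Finset.sum_eq_single (τ c)]
  · simp
  · intro b _ hb
    simp [hb]
  · simp

variable [DecidableEq E]

/-- The edges `φ c` with `τ c = i`. -/
def colorClass (φ : Fin k × {v : V // v ≠ r} → E × Sym2 V)
    (τ : Fin k × {v : V // v ≠ r} → Fin k) (i : Fin k) : LabeledGraph V E :=
  (univ.filter fun c => τ c = i).image φ

lemma mem_colorClass {φ : Fin k × {v : V // v ≠ r} → E × Sym2 V}
    {τ : Fin k × {v : V // v ≠ r} → Fin k} {i : Fin k} {p : E × Sym2 V} :
    p ∈ colorClass φ τ i ↔ ∃ c, τ c = i ∧ φ c = p := by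
  simp [colorClass]

lemma colorClass_injective {φ : Fin k × {v : V // v ≠ r} → E × Sym2 V}
    (hφ : Function.Injective φ) : Function.Injective (colorClass φ) := by
  intro τ τ' h
  funext c
  have : φ c ∈ colorClass φ τ' (τ c) := h ▸ mem_colorClass.2 ⟨c, rfl, rfl⟩
  obtain ⟨c', h1, h2⟩ := mem_colorClass.1 this
  rw [← h1, hφ h2]

/-- The simple graph underlying a labelled graph. -/
abbrev underlyingGraph (T : LabeledGraph V E) : SimpleGraph V :=
  SimpleGraph.fromEdgeSet (Prod.snd '' (T : Set (E × Sym2 V)))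

/-- The kernel of `blockMatrix F φ τ` contains the indicator function of a union of connected
components of a color class that avoids the root. -/
lemma connected_colorClass_of_det_ne_zero {φ : Fin k × {v : V // v ≠ r} → E × Sym2 V}
    {τ : Fin k × {v : V // v ≠ r} → Fin k} (h : (blockMatrix F φ τ).det ≠ 0) (i : Fin k) :
    (underlyingGraph (colorClass φ τ i)).Connected := by
  classical
  set Γ := underlyingGraph (colorClass φ τ i) with hΓ
  have key : ∀ w, Γ.Reachable r w := by
    by_contra! hw
    obtain ⟨w, hw⟩ := hw
    apply h
    rw [← Matrix.exists_mulVec_eq_zero_iff]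
    have hwr : w ≠ r := by
      rintro rfl
      exact hw (SimpleGraph.Reachable.refl _)
    refine ⟨fun d => if d.1 = i ∧ ¬ Γ.Reachable r d.2 then 1 else 0, fun h0 => ?_, ?_⟩
    · simpa [hw] using congrFun h0 (i, ⟨w, hwr⟩)
    · funext c
      rw [blockMatrix_mulVec]
      have hext : ∀ u : V, extendByZero r (fun v : {v : V // v ≠ r} =>
          if τ c = i ∧ ¬ Γ.Reachable r v then (1 : F) else 0) u =
          if τ c = i ∧ ¬ Γ.Reachable r u then 1 else 0 := by
        intro u
        unfold extendByZero
        split_ifs <;> simp_all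
      simp only [hext, Pi.zero_apply, sub_eq_zero]
      by_cases hc : τ c = i
      · have : Γ.Reachable (Quot.out (φ c).2).1 (Quot.out (φ c).2).2 := by
          by_cases hne : (Quot.out (φ c).2).1 = (Quot.out (φ c).2).2
          · rw [hne]
          · refine SimpleGraph.Adj.reachable ?_
            rw [hΓ, SimpleGraph.fromEdgeSet_adj]
            refine ⟨⟨φ c, mem_coe.2 (mem_colorClass.2 ⟨c, hc, rfl⟩), ?_⟩, hne⟩
            exact (mk_out_eq _).symm
        have h2 : Γ.Reachable r (Quot.out (φ c).2).1 ↔ Γ.Reachable r (Quot.out (φ c).2).2 :=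
          ⟨fun h => h.trans this, fun h => h.trans this.symm⟩
        simp [h2]
      · simp [hc]
  exact { preconnected := fun u v => (key u).symm.trans (key v), nonempty := ⟨r⟩ }

lemma det_ne_zero_of_connected {φ : Fin k × {v : V // v ≠ r} → E × Sym2 V}
    {τ : Fin k × {v : V // v ≠ r} → Fin k}
    (h : ∀ i, (underlyingGraph (colorClass φ τ i)).Connected) :
    (blockMatrix F φ τ).det ≠ 0 := by
  intro h0
  rw [← Matrix.exists_mulVec_eq_zero_iff] at h0
  obtain ⟨x, hx, hx0⟩ := h0
  apply hx
  funext ⟨i, v⟩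
  set X : V → F := extendByZero r (fun v => x (i, v)) with hX
  have hadj : ∀ u w, (underlyingGraph (colorClass φ τ i)).Adj u w → X u = X w := by
    intro u w huw
    rw [SimpleGraph.fromEdgeSet_adj] at huw
    obtain ⟨⟨p, hp, hps⟩, -⟩ := huw
    obtain ⟨c, hc, rfl⟩ := mem_colorClass.1 (mem_coe.1 hp)
    have h1 := congrFun hx0 c
    rw [blockMatrix_mulVec, hc, ← hX, Pi.zero_apply, sub_eq_zero] at h1
    have h2 : s((Quot.out (φ c).2).1, (Quot.out (φ c).2).2) = s(u, w) := (mk_out_eq _).trans hps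
    rcases Sym2.eq_iff.1 h2 with ⟨h3, h4⟩ | ⟨h3, h4⟩
    · rw [← h3, ← h4, h1]
    · rw [← h3, ← h4, h1]
  have hreach : ∀ u w, (underlyingGraph (colorClass φ τ i)).Reachable u w → X u = X w := by
    rintro u w ⟨p⟩
    induction p with
    | nil => rfl
    | cons hh _ ih => exact (hadj _ _ hh).trans ih
  have h3 := hreach v r ((h i).preconnected _ _)
  simpa [hX, extendByZero, v.2] using h3

/-- An edge partition into `k` connected spanning subgraphs is one into spanning trees when there
are only `k (|V| - 1)` edges. -/
lemma isTreeDecomposition_of_connected {G : LabeledGraph V E} (hloop : ∀ p ∈ G, ¬ p.2.IsDiag)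
    (hcard : #G = k * (Fintype.card V - 1)) {T : Fin k → LabeledGraph V E}
    (hdisj : ∀ i j, i ≠ j → Disjoint (T i) (T j)) (hmem : ∀ p, p ∈ G ↔ ∃ i, p ∈ T i)
    (hconn : ∀ i, (underlyingGraph (T i)).Connected) : IsTreeDecomposition G T := by
  refine ⟨?_, hdisj, hmem⟩
  have hloopT : ∀ i, ∀ p ∈ T i, ¬ p.2.IsDiag := fun i p hp => hloop p ((hmem p).2 ⟨i, hp⟩)
  have hedge : ∀ i, (underlyingGraph (T i)).edgeSet = ((T i).image Prod.snd : Finset (Sym2 V)) := by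
    intro i
    rw [SimpleGraph.edgeSet_fromEdgeSet, coe_image]
    refine sdiff_eq_left.2 ?_
    rw [Set.disjoint_left]
    rintro _ ⟨p, hp, rfl⟩ hd
    exact hloopT i p hp hd
  have hle : ∀ i, #((T i).image Prod.snd) ≤ #(T i) := fun i => card_image_le
  have hge : ∀ i, Fintype.card V - 1 ≤ #((T i).image Prod.snd) := by
    intro i
    have := (hconn i).card_vert_le_card_edgeSet_add_one
    rw [hedge i, Nat.card_eq_fintype_card, Nat.card_coe_set_eq, Set.ncard_coe_finset] at this
    omega
  have hsum : ∑ i, #(T i) = ∑ _i : Fin k, (Fintype.card V - 1) := by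
    rw [← card_biUnion (fun i _ j _ hij => hdisj i j hij)]
    have : univ.biUnion T = G := by
      ext p
      simp [hmem]
    rw [this, hcard]
    simp
  -- Each class has at least `|V| - 1` edges, and the total leaves no room for more.
  have heq : ∀ i, Fintype.card V - 1 = #(T i) := by
    have := (Finset.sum_eq_sum_iff_of_le (s := univ) (f := fun _ : Fin k => Fintype.card V - 1)
      (g := fun i => #(T i)) (fun i _ => (hge i).trans (hle i))).1 hsum.symm
    exact fun i => this i (mem_univ i)
  intro i
  have h1 : #((T i).image Prod.snd) = #(T i) :=
    le_antisymm (hle i) ((heq i).symm.le.trans (hge i))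
  refine ⟨hloopT i, card_image_iff.1 h1, SimpleGraph.isTree_iff_connected_and_card.2 ⟨hconn i, ?_⟩⟩
  have hV : 0 < Fintype.card V := Fintype.card_pos_iff.2 (hconn i).nonempty
  change Nat.card (underlyingGraph (T i)).edgeSet + 1 = Nat.card V
  rw [hedge i, Nat.card_coe_set_eq, Set.ncard_coe_finset, h1, ← heq i, Nat.card_eq_fintype_card]
  omega

lemma signature_colorClass {φ : Fin k × {v : V // v ≠ r} → E × Sym2 V}
    (hφ : Function.Injective φ) (τ : Fin k × {v : V // v ≠ r} → Fin k) (e : E) :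
    signature (colorClass φ τ) e = ∑ c, if (φ c).1 = e then (τ c : ℕ) else 0 := by
  have h : ∀ i : Fin k, (i : ℕ) * #{p ∈ colorClass φ τ i | p.1 = e} =
      ∑ c, if τ c = i then (if (φ c).1 = e then (i : ℕ) else 0) else 0 := by
    intro i
    rw [colorClass, filter_image, card_image_of_injective _ hφ, filter_filter,
      Finset.card_filter, Finset.mul_sum]
    refine Finset.sum_congr rfl fun c _ => ?_
    by_cases h1 : τ c = i <;> by_cases h2 : (φ c).1 = e <;> simp [h1, h2]
  unfold signature
  simp only [h]
  rw [Finset.sum_comm]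
  simp

variable [Fintype E]

/-- The determinant of `evaluationMatrix φ α` as a polynomial in `α`, with its terms grouped
by the way the edges are distributed over the column blocks. -/
noncomputable def evaluationDet (F : Type*) [Field F]
    (φ : Fin k × {v : V // v ≠ r} → E × Sym2 V) : MvPolynomial E F :=
  ∑ τ : Fin k × {v : V // v ≠ r} → Fin k,
    MvPolynomial.monomial (Finsupp.equivFunOnFinite.symm (signature (colorClass φ τ)))
      (blockMatrix F φ τ).det

lemma eval_evaluationDet {φ : Fin k × {v : V // v ≠ r} → E × Sym2 V}
    (hφ : Function.Injective φ) (α : E → F) :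
    MvPolynomial.eval α (evaluationDet F φ) = (evaluationMatrix φ α).det := by
  rw [det_evaluationMatrix, evaluationDet, map_sum]
  refine Finset.sum_congr rfl fun τ _ => ?_
  rw [MvPolynomial.eval_monomial, mul_comm, Finsupp.prod_fintype _ _ (by simp)]
  congr 1
  simp only [Finsupp.equivFunOnFinite_symm_apply_apply, signature_colorClass hφ,
    ← Finset.prod_pow_eq_pow_sum]
  rw [Finset.prod_comm]
  refine Finset.prod_congr rfl fun c _ => ?_
  rw [Finset.prod_eq_single (φ c).1]
  · simp
  · intro e _ he
    simp [he.symm]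
  · simp

lemma totalDegree_evaluationDet_le {φ : Fin k × {v : V // v ≠ r} → E × Sym2 V}
    (hφ : Function.Injective φ) :
    (evaluationDet F φ).totalDegree ≤ k * (Fintype.card V - 1) * k := by
  refine MvPolynomial.totalDegree_finsetSum_le fun τ _ =>
    (MvPolynomial.totalDegree_monomial_le _ _).trans ?_
  change (Finsupp.equivFunOnFinite.symm (signature (colorClass φ τ))).sum (fun _ m => m) ≤ _
  rw [Finsupp.sum_fintype _ _ (by simp)]
  simp only [Finsupp.equivFunOnFinite_symm_apply_apply, signature_colorClass hφ]
  rw [Finset.sum_comm]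
  calc ∑ c, ∑ e, (if (φ c).1 = e then (τ c : ℕ) else 0)
      ≤ ∑ _c : Fin k × {v : V // v ≠ r}, k := by
        refine Finset.sum_le_sum fun c _ => ?_
        simp
    _ = k * (Fintype.card V - 1) * k := by
        simp [Fintype.card_subtype_compl]

/-- The monomial given by the distinguished signature receives the contribution of exactly one
spanning-tree decomposition, so nothing can cancel it, in any characteristic. -/
lemma evaluationDet_ne_zero {φ : Fin k × {v : V // v ≠ r} → E × Sym2 V}
    (hφ : Function.Injective φ) {G : LabeledGraph V E} (hG : ∀ p, p ∈ G ↔ ∃ c, φ c = p)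
    (hloop : ∀ p ∈ G, ¬ p.2.IsDiag) (hdist : IsDistinguishable k G) :
    evaluationDet F φ ≠ 0 := by
  obtain ⟨hcard, T, hT, huniq⟩ := hdist
  have hmemT : ∀ c, ∃ i, φ c ∈ T i := fun c => (hT.2.2 _).1 ((hG _).2 ⟨c, rfl⟩)
  choose τ₀ hτ₀ using hmemT
  have hT₀ : colorClass φ τ₀ = T := by
    funext i
    ext p
    rw [mem_colorClass]
    constructor
    · rintro ⟨c, rfl, rfl⟩
      exact hτ₀ c
    · intro hp
      obtain ⟨c, rfl⟩ := (hG p).1 ((hT.2.2 p).2 ⟨i, hp⟩)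
      refine ⟨c, ?_, rfl⟩
      by_contra hne
      exact Finset.disjoint_left.1 (hT.2.1 _ _ hne) (hτ₀ c) hp
  have hdet₀ : (blockMatrix F φ τ₀).det ≠ 0 :=
    det_ne_zero_of_connected fun i => hT₀ ▸ (hT.1 i).2.2.connected
  intro h0
  apply hdet₀
  have hcoeff := congrArg
    (MvPolynomial.coeff (Finsupp.equivFunOnFinite.symm (signature T))) h0
  rw [evaluationDet, MvPolynomial.coeff_sum, MvPolynomial.coeff_zero,
    Finset.sum_eq_single τ₀] at hcoeff
  · simpa [hT₀] using hcoeff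
  · intro τ _ hne
    rw [MvPolynomial.coeff_monomial]
    split_ifs with hsig
    -- A nonzero coefficient comes from a tree decomposition, which the signature determines.
    · by_contra hdet
      apply hne
      apply colorClass_injective hφ
      rw [hT₀]
      refine huniq _ (isTreeDecomposition_of_connected hloop hcard ?_ ?_
        (connected_colorClass_of_det_ne_zero hdet)) (Finsupp.equivFunOnFinite.symm.injective hsig)
      · intro i j hij
        rw [Finset.disjoint_left]
        intro p hp hp'
        obtain ⟨c, rfl, rfl⟩ := mem_colorClass.1 hp
        obtain ⟨c', rfl, h'⟩ := mem_colorClass.1 hp'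
        exact hij (by rw [hφ h'])
      · intro p
        rw [hG]
        simp [mem_colorClass]
    · rfl
  · simp

/-- For generic `α`, polynomials of degree `< k` attached to the vertices of a `k`-distinguishable
graph agree as soon as the two polynomials along each edge labelled `e` agree at `α e`. -/
lemma exists_polynomial_of_isDistinguishable (F : Type*) [Field F] {G : LabeledGraph V E}
    (r : V) (hloop : ∀ p ∈ G, ¬ p.2.IsDiag) (hdist : IsDistinguishable k G) :
    ∃ D : MvPolynomial E F, D ≠ 0 ∧ D.totalDegree ≤ k * (Fintype.card V - 1) * k ∧
      ∀ α : E → F, MvPolynomial.eval α D ≠ 0 → ∀ f : V → F[X],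
        (∀ v, (f v).degree < (k : WithBot ℕ)) →
        (∀ p ∈ G, ∀ u v, p.2 = s(u, v) → (f u).eval (α p.1) = (f v).eval (α p.1)) →
        ∀ v, f v = f r := by
  have hc : Fintype.card (Fin k × {v : V // v ≠ r}) = Fintype.card G := by
    simp [Fintype.card_subtype_compl, hdist.1]
  let φ' := Fintype.equivOfCardEq hc
  let φ : Fin k × {v : V // v ≠ r} → E × Sym2 V := fun c => (φ' c : E × Sym2 V)
  have hφ : Function.Injective φ := Subtype.val_injective.comp φ'.injective
  have hG : ∀ p, p ∈ G ↔ ∃ c, φ c = p := by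
    intro p
    constructor
    · intro hp
      exact ⟨φ'.symm ⟨p, hp⟩, by simp [φ]⟩
    · rintro ⟨c, rfl⟩
      exact (φ' c).2
  refine ⟨evaluationDet F φ, evaluationDet_ne_zero hφ hG hloop hdist,
    totalDegree_evaluationDet_le hφ, ?_⟩
  intro α hα f hdeg hedge
  rw [eval_evaluationDet hφ] at hα
  have heval : ∀ u a, (f u).eval a = ∑ i : Fin k, (f u).coeff i * a ^ (i : ℕ) := by
    intro u a
    exact Polynomial.eval_eq_sum_degreeLTEquiv (Polynomial.mem_degreeLT.2 (hdeg u)) a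
  let x : Fin k × {v : V // v ≠ r} → F := fun d => (f d.2).coeff d.1 - (f r).coeff d.1
  have hx : (evaluationMatrix φ α).mulVec x = 0 := by
    funext c
    have hext : ∀ (i : Fin k) (u : V), extendByZero r (fun v => x (i, v)) u =
        (f u).coeff i - (f r).coeff i := by
      intro i u
      unfold extendByZero
      split_ifs with h
      · rfl
      · simp [not_not.1 h]
    have h1 := hedge (φ c) ((hG _).2 ⟨c, rfl⟩) _ _ (mk_out_eq _).symm
    rw [heval, heval, ← sub_eq_zero, ← Finset.sum_sub_distrib] at h1
    simp only [Matrix.mulVec, dotProduct, evaluationMatrix, Fintype.sum_prod_type, mul_assoc,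
      ← Finset.mul_sum, sum_incidenceRow_mul, hext, Pi.zero_apply]
    rw [← h1]
    refine Finset.sum_congr rfl fun i _ => ?_
    ring
  have hx0 : x = 0 := by
    by_contra hne
    exact hα (Matrix.exists_mulVec_eq_zero_iff.1 ⟨x, hne, hx⟩)
  intro v
  by_cases hv : v = r
  · rw [hv]
  · ext i
    by_cases hi : i < k
    · exact sub_eq_zero.1 (congrFun hx0 (⟨i, hi⟩, ⟨v, hv⟩))
    · have hle : (k : WithBot ℕ) ≤ i := by exact_mod_cast not_lt.1 hi
      rw [Polynomial.coeff_eq_zero_of_degree_lt ((hdeg v).trans_le hle),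
        Polynomial.coeff_eq_zero_of_degree_lt ((hdeg r).trans_le hle)]

end Determinant

/-! ### Generic evaluation points -/

lemma exists_eval_ne_zero_of_sum_totalDegree_lt_card {F σ ι : Type*} [Field F] [Fintype F]
    [Finite σ] (s : Finset ι) (p : ι → MvPolynomial σ F) (hp : ∀ i ∈ s, p i ≠ 0)
    (hcard : ∑ i ∈ s, (p i).totalDegree < Fintype.card F) :
    ∃ α : σ → F, ∀ i ∈ s, MvPolynomial.eval α (p i) ≠ 0 := by
  by_contra! h
  refine Finset.prod_ne_zero_iff.2 hp ?_
  refine MvPolynomial.eq_zero_of_eval_zero_at_prod_finset _ (fun _ => univ) (fun i => ?_)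
    (fun α _ => ?_)
  · rw [card_univ]
    exact ((MvPolynomial.degreeOf_le_totalDegree _ _).trans
      (MvPolynomial.totalDegree_finsetProd _ _)).trans_lt hcard
  · obtain ⟨i, hi, h0⟩ := h α
    rw [map_prod]
    exact Finset.prod_eq_zero hi h0

/-- `α` is generic for `k`-distinguishable graphs on at most `N` vertices: polynomials of degree
`< k` attached to the vertices are all equal once, for each edge labelled `e`, those at its two
ends agree at `α e`. -/
def IsGenericForGraphs {F : Type*} [Field F] {n : ℕ} (k N : ℕ) (α : Fin n → F) : Prop :=
  ∀ t, t ≤ N → ∀ G : LabeledGraph (Fin t) (Fin n), (∀ p ∈ G, ¬ p.2.IsDiag) →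
    IsDistinguishable k G → ∀ f : Fin t → F[X], (∀ v, (f v).degree < (k : WithBot ℕ)) →
      (∀ p ∈ G, ∀ u v, p.2 = s(u, v) → (f u).eval (α p.1) = (f v).eval (α p.1)) →
        ∀ u v, f u = f v

/-- A field size beyond which generic points exist: `n * n` bounds the total degree of the
polynomials `X i - X j`, and every graph on at most `L + 1` vertices accounts for one determinant,
of degree at most `n * L * n`. -/
def fieldSizeBound (n L : ℕ) : ℕ :=
  n * n + (∑ t : Fin (L + 2), Fintype.card (LabeledGraph (Fin t) (Fin n))) * (n * L * n) + 1

lemma exists_injective_isGenericForGraphs {F : Type*} [Field F] [Fintype F] {n k L : ℕ}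
    (hkn : k ≤ n) (hF : fieldSizeBound n L ≤ Fintype.card F) :
    ∃ α : Fin n → F, Function.Injective α ∧ IsGenericForGraphs k (L + 1) α := by
  classical
  have hD : ∀ g : (t : Fin (L + 2)) × LabeledGraph (Fin t) (Fin n),
      ∃ D : MvPolynomial (Fin n) F, D ≠ 0 ∧ D.totalDegree ≤ n * L * n ∧
        ∀ α : Fin n → F, MvPolynomial.eval α D ≠ 0 → (∀ p ∈ g.2, ¬ p.2.IsDiag) →
          IsDistinguishable k g.2 → ∀ f : Fin g.1 → F[X],
          (∀ v, (f v).degree < (k : WithBot ℕ)) →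
          (∀ p ∈ g.2, ∀ u v, p.2 = s(u, v) → (f u).eval (α p.1) = (f v).eval (α p.1)) →
          ∀ u v, f u = f v := by
    rintro ⟨t, G⟩
    by_cases h : (∀ p ∈ G, ¬ p.2.IsDiag) ∧ IsDistinguishable k G ∧ 0 < (t : ℕ)
    · obtain ⟨D, hD0, hdeg, hD⟩ :=
        exists_polynomial_of_isDistinguishable F (⟨0, h.2.2⟩ : Fin t) h.1 h.2.1
      refine ⟨D, hD0, hdeg.trans ?_, fun α hα _ _ f hf hedge u v => ?_⟩
      · have := t.2
        rw [Fintype.card_fin]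
        gcongr
        omega
      · rw [hD α hα f hf hedge u, hD α hα f hf hedge v]
    · refine ⟨1, one_ne_zero, by simp, fun α _ h1 h2 f _ _ u => ?_⟩
      exact absurd ⟨h1, h2, u.pos⟩ h
  choose D hD0 hDdeg hDgen using hD
  let p : (Fin n × Fin n) ⊕ ((t : Fin (L + 2)) × LabeledGraph (Fin t) (Fin n)) →
      MvPolynomial (Fin n) F :=
    Sum.elim (fun d => if d.1 = d.2 then 1 else MvPolynomial.X d.1 - MvPolynomial.X d.2) D
  have hp : ∀ x ∈ univ, p x ≠ 0 := by
    rintro (⟨i, j⟩ | g) -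
    · by_cases hij : i = j
      · simp [p, hij]
      · simp only [p, Sum.elim_inl, hij, if_false]
        exact sub_ne_zero.2 fun h => hij (MvPolynomial.X_injective h)
    · exact hD0 g
  have hdeg : ∑ x, (p x).totalDegree < Fintype.card F := by
    rw [Fintype.sum_sum_type]
    have h1 : ∑ d : Fin n × Fin n, (p (Sum.inl d)).totalDegree ≤ n * n := by
      refine (Finset.sum_le_card_nsmul univ _ 1 fun d _ => ?_).trans (by simp)
      by_cases hd : d.1 = d.2
      · simp [p, hd]
      · simp only [p, Sum.elim_inl, hd, if_false]
        exact (MvPolynomial.totalDegree_sub _ _).trans (by simp)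
    have h2 : ∑ g, (p (Sum.inr g)).totalDegree ≤
        (∑ t : Fin (L + 2), Fintype.card (LabeledGraph (Fin t) (Fin n))) * (n * L * n) := by
      refine (Finset.sum_le_card_nsmul univ _ (n * L * n) fun g _ => hDdeg g).trans ?_
      rw [card_univ, Fintype.card_sigma, smul_eq_mul]
    unfold fieldSizeBound at hF
    omega
  obtain ⟨α, hα⟩ := exists_eval_ne_zero_of_sum_totalDegree_lt_card univ p hp hdeg
  refine ⟨α, fun i j hij => ?_, fun t ht G hloop hG => ?_⟩
  · by_contra hne
    exact hα (Sum.inl (i, j)) (mem_univ _) (by simp [p, hne, hij])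
  · exact hDgen ⟨⟨t, by omega⟩, G⟩ α (hα (Sum.inr ⟨⟨t, by omega⟩, G⟩) (mem_univ _)) hloop hG

/-! ### Reed–Solomon codes -/

lemma codeRate_rsCode {F : Type*} [Field F] [Fintype F] {n k : ℕ} (hkn : k ≤ n) {α : Fin n → F}
    (hα : Function.Injective α) : codeRate (rsCode k α) = (k : ℝ) / n := by
  have hcard : Nat.card (rsCode k α) = Fintype.card F ^ k := by
    let ev : Polynomial.degreeLT F k → Fin n → F := fun f i => (f : F[X]).eval (α i)
    have hev : Function.Injective ev := by
      intro f g hfg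
      refine Subtype.ext (Polynomial.eq_of_degrees_lt_of_eval_index_eq univ hα.injOn
        ?_ ?_ fun i _ => congrFun hfg i)
      · exact (Polynomial.mem_degreeLT.1 f.2).trans_le (by simpa using hkn)
      · exact (Polynomial.mem_degreeLT.1 g.2).trans_le (by simpa using hkn)
    have hrange : rsCode k α = Set.range ev := by
      ext c
      constructor
      · rintro ⟨f, hf, rfl⟩
        exact ⟨⟨f, Polynomial.mem_degreeLT.2 hf⟩, rfl⟩
      · rintro ⟨f, rfl⟩
        exact ⟨f, Polynomial.mem_degreeLT.1 f.2, rfl⟩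
    rw [hrange, Nat.card_range_of_injective hev,
      Nat.card_congr (Polynomial.degreeLTEquiv F k).toEquiv]
    simp
  have hq : (1 : ℝ) < Fintype.card F := by exact_mod_cast Fintype.one_lt_card
  rw [codeRate, hcard, Nat.cast_pow, Real.logb_pow, Real.logb_self_eq_one hq, mul_one]

/-- Double counting of the agreements between `y` and the words `c j`. -/
lemma sum_card_agreement {F ι : Type*} [DecidableEq F] [Fintype ι] {n : ℕ} (c : ι → Fin n → F)
    (y : Fin n → F) :
    ∑ i, #{j | c j i = y i} + ∑ j, hammingDist (c j) y = Fintype.card ι * n := by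
  simp only [hammingDist, Finset.card_filter]
  rw [Finset.sum_comm, ← Finset.sum_add_distrib]
  simp only [← Finset.sum_add_distrib]
  have : ∀ j i, ((if c j i = y i then 1 else 0) + if c j i ≠ y i then 1 else 0) = 1 := by
    intro j i
    by_cases h : c j i = y i <;> simp [h]
  simp only [this]
  simp

/-- Too large a list makes the agreement hypergraph (vertices: the words of the list; one edge for
each coordinate, consisting of the words that agree with `y` there) dense enough for the hypergraph
conjecture, which at a generic point forces words of the list to coincide. -/
lemma isListDecodable_of_isGenericForGraphs {F : Type*} [Field F] [DecidableEq F] {n k L : ℕ} {C : ℝ}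
    (hL : 1 ≤ L) (hconj : ∀ t : ℕ, 1 ≤ t → t ≤ L + 1 → HypergraphConjecture C t)
    (hk : 1 ≤ k) (hn : 0 < n) {α : Fin n → F} (hα : IsGenericForGraphs k (L + 1) α) :
    IsListDecodable (rsCode k α) ((L : ℝ) / (L + 1) * (1 - C * ((k : ℝ) / n))) L := by
  intro y
  by_contra! hlt
  obtain ⟨B, hBsub, hBcard⟩ := Set.exists_subset_encard_eq (Order.add_one_le_of_lt hlt)
  have hBfin : B.Finite := Set.finite_of_encard_eq_coe (k := L + 1) (by simpa using hBcard)
  have hBn : Nat.card B = L + 1 := by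
    rw [Nat.card_coe_set_eq, Set.ncard, hBcard]
    rfl
  have : Finite B := hBfin
  let c : Fin (L + 1) → Fin n → F := fun j => ((Finite.equivFinOfCardEq hBn).symm j : Fin n → F)
  have hcinj : Function.Injective c := Subtype.val_injective.comp (Equiv.injective _)
  have hcB : ∀ j, c j ∈ B := fun j => Subtype.coe_prop _
  have hcode : ∀ j, ∃ f : F[X], f.degree < (k : WithBot ℕ) ∧ c j = fun i => f.eval (α i) :=
    fun j => (hBsub (hcB j)).1
  choose f hfdeg hfc using hcode
  have hfinj : Function.Injective f := fun i j hij => hcinj (by rw [hfc, hfc, hij])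
  have hn' : (0 : ℝ) < n := by exact_mod_cast hn
  have hdist : ∀ j, ((L : ℝ) + 1) * hammingDist (c j) y ≤ L * (n - C * k) := by
    intro j
    have h := (hBsub (hcB j)).2
    rw [div_le_iff₀ hn'] at h
    calc ((L : ℝ) + 1) * hammingDist (c j) y
        ≤ (L + 1) * (L / (L + 1) * (1 - C * (k / n)) * n) := by gcongr
      _ = L * (n - C * k) := by field_simp
  let S : Fin n → Finset (Fin (L + 1)) := fun i => {j | c j i = y i}
  have hdense : C * k * ((Fintype.card (Fin (L + 1)) : ℝ) - 1) ≤
      ∑ i, ((#(S i) - 1 : ℕ) : ℝ) := by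
    have h1 : (∑ i, (#(S i) : ℝ)) + ∑ j, (hammingDist (c j) y : ℝ) = (L + 1) * n := by
      have := sum_card_agreement c y
      rw [Fintype.card_fin] at this
      exact_mod_cast this
    have h2 : ∑ j, (hammingDist (c j) y : ℝ) ≤ L * (n - C * k) := by
      have h3 := Finset.sum_le_sum fun j (_ : j ∈ (univ : Finset (Fin (L + 1)))) => hdist j
      rw [← Finset.mul_sum, Finset.sum_const, card_univ, Fintype.card_fin, nsmul_eq_mul] at h3
      push_cast at h3
      exact le_of_mul_le_mul_left h3 (by positivity)
    have h4 : (∑ i, (#(S i) : ℝ)) - n ≤ ∑ i, ((#(S i) - 1 : ℕ) : ℝ) := by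
      have h5 : ∀ i, (#(S i) : ℝ) - 1 ≤ ((#(S i) - 1 : ℕ) : ℝ) := by
        intro i
        rw [sub_le_iff_le_add]
        exact_mod_cast (le_tsub_add : #(S i) ≤ #(S i) - 1 + 1)
      have h6 := Finset.sum_le_sum fun i (_ : i ∈ (univ : Finset (Fin n))) => h5 i
      rw [Finset.sum_sub_distrib] at h6
      simpa using h6
    rw [Fintype.card_fin]
    push_cast
    linarith
  obtain ⟨t, ht2, htL, ψ, H, hH, hψ⟩ := exists_weaklyPartitionConnected (C * k) S
    (by rw [Fintype.card_fin]; omega) hdense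
  rw [Fintype.card_fin] at htL
  obtain ⟨G, hG, G', hG'G, hG'⟩ := hconj t (by omega) htL k hk n H hH
  have hall := hα t htL G' (fun p hp => (hG.1 p (hG'G hp)).1) hG' (fun v => f (ψ v))
    (fun v => hfdeg _) ?_
  · have := ψ.injective (hfinj (hall ⟨0, by omega⟩ ⟨1, by omega⟩))
    simp at this
  · intro p hp u v huv
    obtain ⟨hdiag, hmem⟩ := hG.1 p (hG'G hp)
    rw [huv] at hdiag hmem
    have hu := hmem u (Sym2.mem_mk_left _ _)
    have hv := hmem v (Sym2.mem_mk_right _ _)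
    have h2 : 2 ≤ #(H.edge p.1) :=
      Finset.one_lt_card.2 ⟨u, hu, v, hv, fun h => hdiag (by simpa using h)⟩
    have hy : ∀ w ∈ H.edge p.1, (f (ψ w)).eval (α p.1) = y p.1 := by
      intro w hw
      have h3 : c (ψ w) p.1 = y p.1 := (mem_filter.1 (hψ p.1 h2 w hw)).2
      rwa [hfc] at h3
    exact (hy u hu).trans (hy v hv).symm

theorem mainTheorem7 :
    ∃ q₀ : ℕ → ℕ → ℕ, ∀ (L : ℕ) (C : ℝ), 1 ≤ L → 1 ≤ C →
      (∀ t : ℕ, 1 ≤ t → t ≤ L + 1 → HypergraphConjecture C t) →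
      ∀ n k : ℕ, 1 ≤ k → k < n →
        ∀ (F : Type*) [Field F] [Fintype F] [DecidableEq F], q₀ n L ≤ Fintype.card F →
          ∃ α : Fin n → F, Function.Injective α ∧
            codeRate (rsCode k α) = (k : ℝ) / n ∧
            IsListDecodable (rsCode k α) ((L : ℝ) / (L + 1) * (1 - C * ((k : ℝ) / n))) L := by
  refine ⟨fieldSizeBound, fun L C hL _ hconj n k hk hkn F _ _ _ hF => ?_⟩
  obtain ⟨α, hinj, hα⟩ := exists_injective_isGenericForGraphs hkn.le hF
  exact ⟨α, hinj, codeRate_rsCode hkn.le hinj,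
    isListDecodable_of_isGenericForGraphs hL hconj hk (by omega) hα⟩
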